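/- Let $k$ be a non-archimedean local field of characteristic different from $2$, and let $$ \mathrm{GSp}(4)=\{g\in \mathrm{GL}_4(k) : {}^t g\, j\, g=\lambda(g)\, j \text{ for some } \lambda(g)\in k^\times\}, \qquad j=\begin{pmatrix}0&0&0&1\\0&0&1&0\\0&-1&0&0\\-1&0&0&0\end{pmatrix}, $$ with the topology induced from $\mathrm{GL}_4(k)$. Let $H\subset \mathrm{GSp}(4)$ be the group of the matrices $$ h(v,z)=\begin{pmatrix}1&v_1&v_2&z\\0&1&0&v_2\\0&0&1&-v_1\\0&0&0&1\end{pmatrix},\qquad v=(v_1,v_2)\in k^2,\ z\in k $$ (the unipotent radical of the Klingen parabolic subgroup, which is the stabilizer of the line spanned by the first basis vector), and let $Z=\{h(0,z): z\in k\}\cong k$ be its center. Let $\pi$ be an irreducible smooth complex representation of $\mathrm{GSp}(4)$ that is not one-dimensional (smooth means that the stabilizer of every vector is open). Then for every nontrivial continuous character $\psi: k\to\mathbb{C}^\times$, regarded as a character of $Z$ through $z\mapsto h(0,z)$, $$ \mathrm{Hom}_Z(\pi,\psi)\neq 0, $$ i.e. there is a nonzero linear functional $\ell:\pi\to\mathbb{C}$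 with $\ell(\pi(h(0,z))v)=\psi(z)\,\ell(v)$ for all $z\in k$ and all vectors $v$ of $\pi$. -/

import Mathlib

open scoped Matrix

namespace FourierJacobi

section Group

variable (k : Type*) [Field k]

/-- The antidiagonal alternating matrix defining the symplectic form. -/
def formJ : Matrix (Fin 4) (Fin 4) k :=
  !![0, 0, 0, 1;
     0, 0, 1, 0;
     0, -1, 0, 0;
     -1, 0, 0, 0]

/-- The symplectic similitude group `GSp(4)`: the invertible matrices `g` with
`ᵗg j g = c j` for some `c ∈ kˣ`. -/
def GSp4 : Subgroup (GL (Fin 4) k) where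
  carrier := {g | ∃ c : kˣ, (g : Matrix (Fin 4) (Fin 4) k)ᵀ * formJ k *
    (g : Matrix (Fin 4) (Fin 4) k) = (c : k) • formJ k}
  one_mem' := ⟨1, by simp⟩
  mul_mem' := by
    rintro a b ⟨c, hc⟩ ⟨d, hd⟩
    refine ⟨c * d, ?_⟩
    have h : ((a * b : GL (Fin 4) k) : Matrix (Fin 4) (Fin 4) k)ᵀ * formJ k *
        ((a * b : GL (Fin 4) k) : Matrix (Fin 4) (Fin 4) k) =
        (b : Matrix (Fin 4) (Fin 4) k)ᵀ * ((a : Matrix (Fin 4) (Fin 4) k)ᵀ * formJ k *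
          (a : Matrix (Fin 4) (Fin 4) k)) * (b : Matrix (Fin 4) (Fin 4) k) := by
      simp [Matrix.transpose_mul, Matrix.mul_assoc]
    rw [h, hc, Matrix.mul_smul, Matrix.smul_mul, hd, smul_smul, Units.val_mul]
  inv_mem' := by
    rintro a ⟨c, hc⟩
    refine ⟨c⁻¹, ?_⟩
    have h1 : (a : Matrix (Fin 4) (Fin 4) k) * ((a⁻¹ : GL (Fin 4) k) : Matrix _ _ k) = 1 := by
      rw [← Units.val_mul, mul_inv_cancel, Units.val_one]
    have h2 : ((a⁻¹ : GL (Fin 4) k) : Matrix (Fin 4) (Fin 4) k)ᵀ *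
        (a : Matrix (Fin 4) (Fin 4) k)ᵀ = 1 := by
      rw [← Matrix.transpose_mul, h1, Matrix.transpose_one]
    have h3 : formJ k = (c : k) • (((a⁻¹ : GL (Fin 4) k) : Matrix (Fin 4) (Fin 4) k)ᵀ *
        formJ k * ((a⁻¹ : GL (Fin 4) k) : Matrix (Fin 4) (Fin 4) k)) := by
      rw [← Matrix.smul_mul, ← Matrix.mul_smul, ← hc]
      calc formJ k = 1 * formJ k * 1 := by simp
        _ = (((a⁻¹ : GL (Fin 4) k) : Matrix (Fin 4) (Fin 4) k)ᵀ *
              (a : Matrix (Fin 4) (Fin 4) k)ᵀ) * formJ k *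
            ((a : Matrix (Fin 4) (Fin 4) k) *
              ((a⁻¹ : GL (Fin 4) k) : Matrix (Fin 4) (Fin 4) k)) := by rw [h2, h1]
        _ = _ := by simp only [Matrix.mul_assoc]
    conv_rhs => rw [h3]
    rw [smul_smul]
    simp

variable {k}

/-- The underlying matrix of `heis v₁ v₂ z`. -/
def heisMatrix (v₁ v₂ z : k) : Matrix (Fin 4) (Fin 4) k :=
  !![1, v₁, v₂, z;
     0, 1, 0, v₂;
     0, 0, 1, -v₁;
     0, 0, 0, 1]

theorem heisMatrix_mul (a b z a' b' z' : k) :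
    heisMatrix a b z * heisMatrix a' b' z' =
      heisMatrix (a + a') (b + b') (z + z' + (a * b' - b * a')) := by
  ext i j
  fin_cases i <;> fin_cases j <;>
    simp [heisMatrix, Matrix.mul_apply, Fin.sum_univ_four] <;> ring

theorem heisMatrix_zero : heisMatrix (0 : k) 0 0 = 1 := by
  ext i j
  fin_cases i <;> fin_cases j <;> simp [heisMatrix]

/-- The element `h(v, z)` of the unipotent radical `H` of the Klingen parabolic subgroup
of `GSp(4)` (the stabilizer of the line spanned by the first basis vector). -/
def heis (v₁ v₂ z : k) : GSp4 k :=
  ⟨⟨heisMatrix v₁ v₂ z, heisMatrix (-v₁) (-v₂) (-z),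
      by rw [heisMatrix_mul, ← heisMatrix_zero]; congr 1 <;> ring,
      by rw [heisMatrix_mul, ← heisMatrix_zero]; congr 1 <;> ring⟩,
    1, by
      ext i j
      fin_cases i <;> fin_cases j <;>
        simp [heisMatrix, formJ, Matrix.mul_apply, Fin.sum_univ_four] <;> ring⟩

theorem heis_mul (a b z a' b' z' : k) :
    heis a b z * heis a' b' z' = heis (a + a') (b + b') (z + z' + (a * b' - b * a')) :=
  Subtype.ext (Units.ext (heisMatrix_mul a b z a' b' z'))

theorem heis_zero : heis (0 : k) 0 0 = 1 :=
  Subtype.ext (Units.ext heisMatrix_zero)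

theorem heis_inj {a b z a' b' z' : k} (h : heis a b z = heis a' b' z') :
    a = a' ∧ b = b' ∧ z = z' := by
  have h' : heisMatrix a b z = heisMatrix a' b' z' :=
    congrArg (fun g : GSp4 k => ((g : GL (Fin 4) k) : Matrix (Fin 4) (Fin 4) k)) h
  refine ⟨?_, ?_, ?_⟩
  · simpa [heisMatrix] using congrFun (congrFun h' 0) 1
  · simpa [heisMatrix] using congrFun (congrFun h' 0) 2
  · simpa [heisMatrix] using congrFun (congrFun h' 0) 3

variable (k) in
/-- The Heisenberg group `H`, the unipotent radical of the Klingen parabolic subgroup. -/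
def heisenberg : Subgroup (GSp4 k) where
  carrier := {g | ∃ v₁ v₂ z : k, heis v₁ v₂ z = g}
  one_mem' := ⟨0, 0, 0, heis_zero⟩
  mul_mem' := by
    rintro _ _ ⟨a, b, z, rfl⟩ ⟨a', b', z', rfl⟩
    exact ⟨_, _, _, (heis_mul a b z a' b' z').symm⟩
  inv_mem' := by
    rintro _ ⟨a, b, z, rfl⟩
    refine ⟨-a, -b, -z, eq_inv_of_mul_eq_one_left ?_⟩
    rw [heis_mul, ← heis_zero]
    congr 1 <;> ring

/-- The isomorphism of `k` with `Z`, as a homomorphism into `GSp(4)`: `z ↦ h(0, z)`. -/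
def zHom : Multiplicative k →* GSp4 k where
  toFun z := heis 0 0 z.toAdd
  map_one' := heis_zero
  map_mul' x y := by rw [heis_mul]; simp

/-- The image `Z` of `zHom` is the center of the Heisenberg group `H`. -/
theorem mem_range_zHom_iff (h2 : (2 : k) ≠ 0) (g : GSp4 k) :
    g ∈ (zHom (k := k)).range ↔ g ∈ (Subgroup.center (heisenberg k)).map (heisenberg k).subtype := by
  constructor
  · rintro ⟨z, rfl⟩
    refine ⟨⟨heis 0 0 z.toAdd, 0, 0, z.toAdd, rfl⟩, ?_, rfl⟩
    refine Subgroup.mem_center_iff.mpr ?_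
    rintro ⟨_, a, b, w, rfl⟩
    refine Subtype.ext ?_
    change heis a b w * heis 0 0 _ = heis 0 0 _ * heis a b w
    rw [heis_mul, heis_mul]
    congr 1 <;> ring
  · rintro ⟨⟨_, a, b, z, rfl⟩, hc, rfl⟩
    have key (a' b' : k) : a' * b - b' * a = a * b' - b * a' := by
      have h := congrArg Subtype.val
        (Subgroup.mem_center_iff.mp hc ⟨heis a' b' 0, a', b', 0, rfl⟩)
      change heis a' b' 0 * heis a b z = heis a b z * heis a' b' 0 at h
      rw [heis_mul, heis_mul] at h
      have := (heis_inj h).2.2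
      linear_combination this
    have ha : a = 0 := by
      have h : (2 : k) * a = 0 := by linear_combination -(key 0 1)
      exact (mul_eq_zero.mp h).resolve_left h2
    have hb : b = 0 := by
      have h : (2 : k) * b = 0 := by linear_combination key 1 0
      exact (mul_eq_zero.mp h).resolve_left h2
    subst ha hb
    exact ⟨Multiplicative.ofAdd z, rfl⟩

end Group

/-- A complex representation of a topological group is smooth if the stabilizer of every
vector is open. -/
def IsSmooth {G V : Type*} [Group G] [TopologicalSpace G] [AddCommGroup V] [Module ℂ V]
    (π : Representation ℂ G V) : Prop :=
  ∀ v : V, IsOpen {g : G | π g v = v}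

/-- `Hom_Z(π, ψ)`: the linear functionals on `π` on which `Z` acts through `ψ`. -/
def homZ {k V : Type*} [Field k] [AddCommGroup V] [Module ℂ V]
    (π : Representation ℂ (GSp4 k) V) (ψ : AddChar k ℂ) : Submodule ℂ (V →ₗ[ℂ] ℂ) where
  carrier := {l | ∀ (z : k) (v : V), l (π (zHom (Multiplicative.ofAdd z)) v) = ψ z * l v}
  zero_mem' := by simp
  add_mem' := by
    intro l m hl hm z v
    simp only [LinearMap.add_apply, hl z v, hm z v, mul_add]
  smul_mem' := by
    intro c l hl z v
    simp only [LinearMap.smul_apply, hl z v, smul_eq_mul]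
    ring

end FourierJacobi

/-!
The proof that `Hom_Z(π, ψ) ≠ 0` has four ingredients.

*Group theory* (`exists_mem_mul_torus`). The conjugates of `Z` are groups of symplectic
transvections. A normal subgroup containing `Z` contains all transvections, and Gaussian elimination
with transvections reduces every element of `GSp(4)` to a torus element `diag(1, 1, c, c)`.

*Characters of `Z`* (`exists_equivariant_functional`). Modulo an open subgroup, `k` is a torsion
group, so each element of `Z` acts with finite order on each vector of `π`. For such a
representation of an abelian group, every nonzero vector survives in a quotient on which the group
acts through a character: take the quotient by a submodule maximal among the invariant ones that
avoid the vector.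

*Self-duality of `k`* (`exists_forall_eq_mul`). Every continuous character of `k` is a multiplicative
shift `x ↦ χ (c x)` of any given nontrivial one `χ`. On a ball this is counting in the dual of a
finite group; compactness yields a scalar `c` that works everywhere.

*Schur's lemma* (`finrank_eq_one_of_commute`) for commuting operators in countable dimension.

If `Z` acts nontrivially, apply the second ingredient to a nonzero vector `π(z₀)v - v`: the
character obtained is nontrivial and continuous, and by the third ingredient it becomes `ψ` after
composing the functional with an element of the torus, which acts on `Z` by scaling. If `Z` acts
trivially, then by the first ingredient all operators of `π` come from the torus, whose orbits in a
smooth representation are countable, so `π` is one-dimensional by the last one.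
-/

namespace FourierJacobi

/-! ### Normal subgroups of `GSp(4)` containing `Z` -/

section Group

variable {k : Type*} [Field k]

/-- The underlying matrix of an element of `GSp(4)`. -/
abbrev toMat (g : GSp4 k) : Matrix (Fin 4) (Fin 4) k := ((g : GL (Fin 4) k) : Matrix _ _ k)

theorem toMat_injective : Function.Injective (toMat : GSp4 k → Matrix (Fin 4) (Fin 4) k) :=
  fun _ _ h => Subtype.ext (Units.ext h)

theorem toMat_mul (g h : GSp4 k) : toMat (g * h) = toMat g * toMat h := rfl

theorem mulVec_toMat_ne_zero (g : GSp4 k) {u : Fin 4 → k} (hu : u ≠ 0) : toMat g *ᵥ u ≠ 0 := by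
  intro h
  apply hu
  have h1 : toMat g⁻¹ * toMat g = 1 := by rw [← toMat_mul, inv_mul_cancel]; rfl
  rw [← Matrix.one_mulVec u, ← h1, ← Matrix.mulVec_mulVec, h, Matrix.mulVec_zero]

/-- The relations between the columns of an element of `GSp(4)`. -/
theorem exists_column_relations (g : GSp4 k) : ∃ c : kˣ, ∀ i j : Fin 4,
    toMat g 0 i * toMat g 3 j + toMat g 1 i * toMat g 2 j - toMat g 2 i * toMat g 1 j -
      toMat g 3 i * toMat g 0 j = c * formJ k i j := by
  obtain ⟨c, hc⟩ := g.2
  refine ⟨c, fun i j => ?_⟩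
  have e := congrFun (congrFun hc i) j
  rw [Matrix.smul_apply, smul_eq_mul] at e
  rw [← e]
  simp [Matrix.mul_apply, Fin.sum_univ_four, formJ]
  ring

theorem vecMul_formJ (u : Fin 4 → k) : u ᵥ* formJ k = ![-u 3, -u 2, u 1, u 0] := by
  ext i
  fin_cases i <;> simp [Matrix.vecMul, dotProduct, Fin.sum_univ_four, formJ]

/-- The matrix of the symplectic transvection `x ↦ x + a ⟨u, x⟩ u`, where `⟨u, x⟩ = ᵗu j x`. -/
def transvMatrix (u : Fin 4 → k) (a : k) : Matrix (Fin 4) (Fin 4) k :=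
  1 + a • Matrix.vecMulVec u (u ᵥ* formJ k)

theorem transvMatrix_mul (u : Fin 4 → k) (a b : k) :
    transvMatrix u a * transvMatrix u b = transvMatrix u (a + b) := by
  have h : Matrix.vecMulVec u (u ᵥ* formJ k) * Matrix.vecMulVec u (u ᵥ* formJ k) = 0 := by
    rw [Matrix.vecMulVec_mul_vecMulVec]
    have : (u ᵥ* formJ k) ⬝ᵥ u = 0 := by
      rw [vecMul_formJ]
      simp [dotProduct, Fin.sum_univ_four]
      ring
    simp [this]
  simp only [transvMatrix, add_mul, mul_add, one_mul, mul_one, Matrix.smul_mul, Matrix.mul_smul, h,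
    smul_zero, add_zero, add_smul]
  abel

theorem transvMatrix_zero (u : Fin 4 → k) : transvMatrix u 0 = 1 := by
  simp [transvMatrix]

/-- The symplectic transvection `x ↦ x + a ⟨u, x⟩ u` as an element of `GSp(4)`. -/
def transv (u : Fin 4 → k) (a : k) : GSp4 k :=
  ⟨⟨transvMatrix u a, transvMatrix u (-a),
      by rw [transvMatrix_mul, add_neg_cancel, transvMatrix_zero],
      by rw [transvMatrix_mul, neg_add_cancel, transvMatrix_zero]⟩,
    1, by
      simp only [transvMatrix, vecMul_formJ]
      ext i j
      fin_cases i <;> fin_cases j <;>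
        simp [formJ, Matrix.mul_apply, Fin.sum_univ_four, Matrix.one_apply] <;> ring⟩

/-- Conjugation in `GSp(4)` carries the transvections along `u` to those along `g u`. -/
theorem exists_conj_transv (g : GSp4 k) : ∃ c : kˣ, ∀ (u : Fin 4 → k) (a : k),
    g * transv u a * g⁻¹ = transv (toMat g *ᵥ u) (c * a) := by
  obtain ⟨c, hc⟩ := g.2
  refine ⟨c⁻¹, fun u a => ?_⟩
  rw [mul_inv_eq_iff_eq_mul]
  apply toMat_injective
  change toMat g * transvMatrix u a = transvMatrix (toMat g *ᵥ u) _ * toMat g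
  have h : (toMat g *ᵥ u) ᵥ* formJ k ᵥ* toMat g = (c : k) • (u ᵥ* formJ k) := by
    rw [← Matrix.vecMul_transpose, Matrix.vecMul_vecMul, Matrix.vecMul_vecMul, ← mul_assoc, hc,
      Matrix.vecMul_smul]
  simp only [transvMatrix, mul_add, add_mul, mul_one, one_mul, Matrix.mul_smul, Matrix.smul_mul,
    Matrix.mul_vecMulVec, Matrix.vecMulVec_mul, h, Matrix.vecMulVec_smul, smul_smul]
  congr 2
  simp [mul_comm]

theorem transv_mulVec (u x : Fin 4 → k) (a : k) :
    toMat (transv u a) *ᵥ x = x + (a * ((u ᵥ* formJ k) ⬝ᵥ x)) • u := by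
  change transvMatrix u a *ᵥ x = _
  ext i
  simp [transvMatrix, Matrix.add_mulVec, Matrix.smul_mulVec, Matrix.vecMulVec_mulVec]
  ring

theorem transv_smul (u : Fin 4 → k) (x a : k) : transv (x • u) a = transv u (x ^ 2 * a) := by
  apply toMat_injective
  change transvMatrix _ _ = transvMatrix _ _
  simp only [transvMatrix, Matrix.smul_vecMul, Matrix.smul_vecMulVec, Matrix.vecMulVec_smul,
    smul_smul]
  congr 2
  ring

theorem transv_single (z : k) : transv ![1, 0, 0, 0] z = heis 0 0 z := by
  apply toMat_injective
  change transvMatrix _ _ = heisMatrix _ _ _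
  simp only [transvMatrix, vecMul_formJ, heisMatrix]
  ext i j
  fin_cases i <;> fin_cases j <;> simp

/-- The underlying matrix of `lowHeis p q r`. -/
def lowHeisMatrix (p q r : k) : Matrix (Fin 4) (Fin 4) k :=
  !![1, 0, 0, 0;
     p, 1, 0, 0;
     q, 0, 1, 0;
     r, q, -p, 1]

theorem lowHeisMatrix_mul_neg (p q r : k) :
    lowHeisMatrix p q r * lowHeisMatrix (-p) (-q) (-r) = 1 := by
  ext i j
  fin_cases i <;> fin_cases j <;>
    simp [lowHeisMatrix, Matrix.mul_apply, Fin.sum_univ_four] <;> ring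

/-- An element of the unipotent radical of the opposite Klingen parabolic subgroup, with first
column `(1, p, q, r)`. -/
def lowHeis (p q r : k) : GSp4 k :=
  ⟨⟨lowHeisMatrix p q r, lowHeisMatrix (-p) (-q) (-r), lowHeisMatrix_mul_neg p q r,
      by simpa using lowHeisMatrix_mul_neg (-p) (-q) (-r)⟩,
    1, by
      ext i j
      fin_cases i <;> fin_cases j <;>
        simp [lowHeisMatrix, formJ, Matrix.mul_apply, Fin.sum_univ_four] <;> ring⟩

/-- The torus element `diag(1, 1, c, c)`, of similitude `c`. -/
def torus : kˣ →* GSp4 k where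
  toFun c := ⟨⟨Matrix.diagonal ![1, 1, c, c], Matrix.diagonal ![1, 1, ↑c⁻¹, ↑c⁻¹],
      by
        rw [Matrix.diagonal_mul_diagonal, ← Matrix.diagonal_one]
        congr 1; ext i; fin_cases i <;> simp,
      by
        rw [Matrix.diagonal_mul_diagonal, ← Matrix.diagonal_one]
        congr 1; ext i; fin_cases i <;> simp⟩,
    c, by
      ext i j
      fin_cases i <;> fin_cases j <;> simp [formJ]⟩
  map_one' := by
    apply toMat_injective
    change Matrix.diagonal _ = 1
    rw [← Matrix.diagonal_one]
    congr 1; ext i; fin_cases i <;> simp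
  map_mul' c d := by
    apply toMat_injective
    change Matrix.diagonal _ = Matrix.diagonal _ * Matrix.diagonal _
    rw [Matrix.diagonal_mul_diagonal]
    congr 1; ext i; fin_cases i <;> simp

theorem toMat_torus (c : kˣ) : toMat (torus c) = Matrix.diagonal ![1, 1, (c : k), c] := rfl

theorem torus_mul_heis (c : kˣ) (z : k) :
    torus c * heis 0 0 (c * z) = heis 0 0 z * torus c := by
  apply toMat_injective
  change Matrix.diagonal ![1, 1, (c : k), c] * heisMatrix _ _ _ =
    heisMatrix _ _ _ * Matrix.diagonal ![1, 1, (c : k), c]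
  ext i j
  fin_cases i <;> fin_cases j <;> simp [heisMatrix, mul_comm]

/-- A nonzero vector pairs nontrivially with some vector off any given coordinate hyperplane. -/
theorem exists_pairing_ne_zero {u : Fin 4 → k} (hu : u ≠ 0) (i : Fin 4) :
    ∃ w : Fin 4 → k, w i ≠ 0 ∧ (w ᵥ* formJ k) ⬝ᵥ u ≠ 0 := by
  obtain ⟨w, hw⟩ : ∃ w : Fin 4 → k, (w ᵥ* formJ k) ⬝ᵥ u ≠ 0 := by
    by_contra! h
    apply hu
    ext j
    fin_cases j
    · simpa [vecMul_formJ, dotProduct, Fin.sum_univ_four] using h ![0, 0, 0, 1]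
    · simpa [vecMul_formJ, dotProduct, Fin.sum_univ_four] using h ![0, 0, 1, 0]
    · simpa [vecMul_formJ, dotProduct, Fin.sum_univ_four] using h ![0, 1, 0, 0]
    · simpa [vecMul_formJ, dotProduct, Fin.sum_univ_four] using h ![1, 0, 0, 0]
  by_cases hwi : w i = 0
  · by_cases hi : ((Pi.single i 1 : Fin 4 → k) ᵥ* formJ k) ⬝ᵥ u = 0
    · refine ⟨w + Pi.single i 1, by simp [hwi], ?_⟩
      rw [Matrix.add_vecMul, add_dotProduct, hi, add_zero]
      exact hw
    · exact ⟨Pi.single i 1, by simp, hi⟩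
  · exact ⟨w, hwi, hw⟩

section Normal

variable {N : Subgroup (GSp4 k)} [hN : N.Normal]

theorem transv_mem_of_apply_zero_ne_zero (hZ : ∀ z : k, heis 0 0 z ∈ N) {u : Fin 4 → k}
    (hu : u 0 ≠ 0) (a : k) : transv u a ∈ N := by
  have hu' : u = u 0 • toMat (lowHeis (u 1 / u 0) (u 2 / u 0) (u 3 / u 0)) *ᵥ ![1, 0, 0, 0] := by
    change u = u 0 • lowHeisMatrix _ _ _ *ᵥ _
    ext i
    fin_cases i <;>
      simp [lowHeisMatrix] <;> field_simp
  obtain ⟨c, hc⟩ := exists_conj_transv (lowHeis (u 1 / u 0) (u 2 / u 0) (u 3 / u 0))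
  have h := hN.conj_mem _ (hZ (↑c⁻¹ * (u 0 ^ 2 * a)))
    (lowHeis (u 1 / u 0) (u 2 / u 0) (u 3 / u 0))
  rw [← transv_single, hc, Units.mul_inv_cancel_left, ← transv_smul, ← hu'] at h
  exact h

theorem transv_mem (hZ : ∀ z : k, heis 0 0 z ∈ N) {u : Fin 4 → k} (hu : u ≠ 0) (a : k) :
    transv u a ∈ N := by
  by_cases h0 : u 0 = 0
  · -- A transvection moves `u` off the hyperplane.
    obtain ⟨w, hw, hwu⟩ := exists_pairing_ne_zero hu 0
    obtain ⟨c, hc⟩ := exists_conj_transv (transv w 1)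
    have h : transv (toMat (transv w 1) *ᵥ u) (c * a) ∈ N := by
      apply transv_mem_of_apply_zero_ne_zero hZ
      simp [transv_mulVec, h0, hw, hwu]
    rw [← hc] at h
    simpa [mul_assoc] using hN.conj_mem _ h (transv w 1)⁻¹
  · exact transv_mem_of_apply_zero_ne_zero hZ h0 a

theorem heis_mem (hZ : ∀ z : k, heis 0 0 z ∈ N) (p q r : k) : heis p q r ∈ N := by
  by_cases h : p = 0 ∧ q = 0
  · rw [h.1, h.2]; exact hZ r
  have hu : (![0, q, -p, 0] : Fin 4 → k) ≠ 0 := by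
    intro hu
    exact h ⟨by simpa using congrFun hu 2, by simpa using congrFun hu 1⟩
  have hu1 : (![1, q, -p, 0] : Fin 4 → k) ≠ 0 := fun hu => by simpa using congrFun hu 0
  have key : heis p q r = transv ![1, q, -p, 0] 1 * transv ![0, q, -p, 0] (-1) *
      heis 0 0 (r - 1) := by
    apply toMat_injective
    change heisMatrix _ _ _ = transvMatrix _ _ * transvMatrix _ _ * heisMatrix _ _ _
    simp only [transvMatrix, vecMul_formJ, heisMatrix]
    ext i j
    fin_cases i <;> fin_cases j <;>
      simp [Matrix.one_apply, Matrix.mul_apply, Fin.sum_univ_four] <;> ring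
  rw [key]
  exact N.mul_mem (N.mul_mem (transv_mem hZ hu1 _) (transv_mem hZ hu _)) (hZ _)

/-- The transvections move every nonzero vector to the first basis vector. -/
theorem exists_mem_mulVec_eq_single (hZ : ∀ z : k, heis 0 0 z ∈ N) {u : Fin 4 → k} (hu : u ≠ 0) :
    ∃ n ∈ N, toMat n *ᵥ u = ![1, 0, 0, 0] := by
  -- When the last coordinate `⟨e₁, u⟩` is nonzero, a transvection along `e₁ - u` does it.
  have key : ∀ u : Fin 4 → k, u 3 ≠ 0 → ∃ n ∈ N, toMat n *ᵥ u = ![1, 0, 0, 0] := by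
    intro u hu
    refine ⟨transv (![1, 0, 0, 0] - u) (u 3)⁻¹, transv_mem hZ (fun h => ?_) _, ?_⟩
    · exact hu (by simpa using congrFun h 3)
    · rw [transv_mulVec]
      have : ((![1, 0, 0, 0] - u) ᵥ* formJ k) ⬝ᵥ u = u 3 := by
        rw [vecMul_formJ]
        simp [dotProduct, Fin.sum_univ_four]
        ring
      rw [this, inv_mul_cancel₀ hu, one_smul]
      abel
  by_cases h3 : u 3 = 0
  · obtain ⟨w, hw3, hwu⟩ := exists_pairing_ne_zero hu 3
    have hw : w ≠ 0 := fun h => hw3 (by simp [h])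
    obtain ⟨n, hn, hnu⟩ := key (toMat (transv w 1) *ᵥ u) (by
      simp [transv_mulVec, h3, hw3, hwu])
    refine ⟨n * transv w 1, N.mul_mem hn (transv_mem hZ hw 1), ?_⟩
    rw [toMat_mul, ← Matrix.mulVec_mulVec, hnu]
  · exact key u h3

/-- The block matrix `diag(1, A, 1)` with `A = !![p, r; q, s]`. -/
def midMatrix (p r q s : k) : Matrix (Fin 4) (Fin 4) k :=
  !![1, 0, 0, 0;
     0, p, r, 0;
     0, q, s, 0;
     0, 0, 0, 1]

theorem toMat_transv_upper (x : k) : toMat (transv ![0, 1, 0, 0] x) = midMatrix 1 x 0 1 := by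
  change transvMatrix _ _ = _
  simp only [transvMatrix, vecMul_formJ, midMatrix]
  ext i j
  fin_cases i <;> fin_cases j <;> simp

theorem toMat_transv_lower (x : k) : toMat (transv ![0, 0, 1, 0] (-x)) = midMatrix 1 0 x 1 := by
  change transvMatrix _ _ = _
  simp only [transvMatrix, vecMul_formJ, midMatrix]
  ext i j
  fin_cases i <;> fin_cases j <;> simp

theorem midMatrix_mul (p r q s p' r' q' s' : k) : midMatrix p r q s * midMatrix p' r' q' s' =
    midMatrix (p * p' + r * q') (p * r' + r * s') (q * p' + s * q') (q * r' + s * s') := by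
  ext i j
  fin_cases i <;> fin_cases j <;> simp [midMatrix, Matrix.mul_apply, Fin.sum_univ_four]

/-- The copy of `SL(2)` in the Levi subgroup is generated by transvections. -/
theorem mem_of_toMat_eq_midMatrix (hZ : ∀ z : k, heis 0 0 z ∈ N) {g : GSp4 k} {p r q s : k}
    (hg : toMat g = midMatrix p r q s) (hdet : p * s - r * q = 1) : g ∈ N := by
  have hU (x : k) : transv ![0, 1, 0, 0] x ∈ N :=
    transv_mem hZ (fun h => by simpa using congrFun h 1) x
  have hL (x : k) : transv ![0, 0, 1, 0] x ∈ N :=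
    transv_mem hZ (fun h => by simpa using congrFun h 2) x
  have key : ∀ (g : GSp4 k) (p r q s : k), toMat g = midMatrix p r q s → p * s - r * q = 1 →
      q ≠ 0 → g ∈ N := by
    intro g p r q s hg hdet hq
    have : g = transv ![0, 1, 0, 0] ((p - 1) / q) * transv ![0, 0, 1, 0] (-q) *
        transv ![0, 1, 0, 0] ((s - 1) / q) := by
      apply toMat_injective
      rw [hg, toMat_mul, toMat_mul, toMat_transv_upper, toMat_transv_upper, toMat_transv_lower,
        midMatrix_mul, midMatrix_mul]
      congr 1
      · field_simp; ring
      · field_simp; linear_combination -hdet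
      · ring
      · field_simp; ring
    rw [this]
    exact N.mul_mem (N.mul_mem (hU _) (hL _)) (hU _)
  by_cases hq : q = 0
  · have hp : p ≠ 0 := by
      rintro rfl
      simp [hq] at hdet
    have := key (transv ![0, 0, 1, 0] (-1) * g) p r (p + q) (r + s)
      (by rw [toMat_mul, hg, toMat_transv_lower, midMatrix_mul]; simp)
      (by linear_combination hdet) (by simpa [hq] using hp)
    exact (N.mul_mem_cancel_left (hL _)).mp this
  · exact key g p r q s hg hdet hq

/-- A normal subgroup of `GSp(4)` that contains `Z` contains the whole symplectic group, so that
modulo it every element is congruent to an element `diag(1, 1, c, c)` of the torus. -/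
theorem exists_mem_mul_torus (hZ : ∀ z : k, heis 0 0 z ∈ N) (g : GSp4 k) :
    ∃ n ∈ N, ∃ c : kˣ, g = n * torus c := by
  -- It suffices to treat another element of the coset `N g`.
  suffices H : ∃ n ∈ N, ∃ m ∈ N, ∃ c : kˣ, n * g = m * torus c by
    obtain ⟨n, hn, m, hm, c, h⟩ := H
    exact ⟨n⁻¹ * m, N.mul_mem (N.inv_mem hn) hm, c, by rw [mul_assoc, ← h, inv_mul_cancel_left]⟩
  obtain ⟨n, hn, hne⟩ := exists_mem_mulVec_eq_single hZ
    (mulVec_toMat_ne_zero g (u := ![1, 0, 0, 0]) (fun h => by simpa using congrFun h 0))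
  rw [Matrix.mulVec_mulVec, ← toMat_mul] at hne
  obtain ⟨c, hc⟩ := exists_column_relations (n * g)
  have hcol (i : Fin 4) : toMat (n * g) i 0 = (![1, 0, 0, 0] : Fin 4 → k) i := by
    rw [← hne]
    simp [Matrix.mulVec, dotProduct, Fin.sum_univ_four]
  have hrow (j : Fin 4) : toMat (n * g) 3 j = c * formJ k 0 j := by
    simpa [hcol] using hc 0 j
  -- A Heisenberg element clears the last column above the diagonal.
  obtain ⟨m, hm, hm0, hm3⟩ : ∃ m ∈ N, (∀ i, toMat (m * (n * g)) i 0 = ![1, 0, 0, 0] i) ∧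
      ∀ i, toMat (m * (n * g)) i 3 = ![0, 0, 0, (c : k)] i := by
    have h33 : toMat (n * g) 3 3 = c := by simp [hrow, formJ]
    generalize n * g = g₁ at *
    refine ⟨heis (toMat g₁ 2 3 / c) (-toMat g₁ 1 3 / c) (-toMat g₁ 0 3 / c), heis_mem hZ _ _ _,
      fun i => ?_, fun i => ?_⟩
    · change ((heisMatrix _ _ _ * toMat g₁ : Matrix _ _ k) i 0 : k) = _
      fin_cases i <;> simp [heisMatrix, Matrix.mul_apply, Fin.sum_univ_four, hcol]
    · change ((heisMatrix _ _ _ * toMat g₁ : Matrix _ _ k) i 3 : k) = _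
      fin_cases i <;> simp [heisMatrix, Matrix.mul_apply, Fin.sum_univ_four, h33]
      field_simp
      ring
  rw [← mul_assoc] at hm0 hm3
  obtain ⟨d, hd⟩ := exists_column_relations (m * n * g)
  have hdc : (d : k) = c := by simpa [hm0, hm3, formJ] using (hd 0 3).symm
  have h31 : toMat (m * n * g) 3 1 = 0 := by simpa [hm0, formJ] using hd 0 1
  have h32 : toMat (m * n * g) 3 2 = 0 := by simpa [hm0, formJ] using hd 0 2
  have h01 : toMat (m * n * g) 0 1 = 0 := by simpa [hm3, formJ] using hd 1 3
  have h02 : toMat (m * n * g) 0 2 = 0 := by simpa [hm3, formJ] using hd 2 3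
  have h12 := hd 1 2
  simp only [h31, h32, h01, h02, hdc, formJ, Matrix.of_apply, Matrix.cons_val, mul_one, mul_zero,
    zero_add, sub_zero] at h12
  refine ⟨m * n, N.mul_mem hm hn, m * n * g * torus c⁻¹, ?_, c, by simp [mul_assoc]⟩
  generalize m * n * g = g₂ at *
  refine mem_of_toMat_eq_midMatrix hZ (p := toMat g₂ 1 1) (r := toMat g₂ 1 2 * ↑c⁻¹)
    (q := toMat g₂ 2 1) (s := toMat g₂ 2 2 * ↑c⁻¹) ?_ ?_
  · rw [toMat_mul, toMat_torus]
    ext i j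
    fin_cases i <;> fin_cases j <;> simp [midMatrix, hm0, hm3, h31, h32, h01, h02]
  · have : (c : k) * ↑c⁻¹ = 1 := c.mul_inv
    linear_combination (↑c⁻¹ : k) * h12 + this

end Normal
end Group
end FourierJacobi

namespace FourierJacobi

/-! ### Characters occurring in torsion representations of abelian groups -/

section LinearAlgebra

variable {V : Type*} [AddCommGroup V] [Module ℂ V]

/-- If `T - ζ` is injective modulo `M` for every `ζ`, then so is every nonzero polynomial
in `T`. -/
theorem mem_of_aeval_apply_mem {T : Module.End ℂ V} {M : Submodule ℂ V}
    (hT : ∀ (ζ : ℂ) (x : V), T x - ζ • x ∈ M → x ∈ M) {p : Polynomial ℂ} (hp : p ≠ 0) {x : V}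
    (hx : Polynomial.aeval T p x ∈ M) : x ∈ M := by
  have key : ∀ (s : Multiset ℂ) (x : V),
      Polynomial.aeval T (s.map fun a => Polynomial.X - Polynomial.C a).prod x ∈ M → x ∈ M := by
    intro s
    induction s using Multiset.induction with
    | empty => intro x hx; simpa using hx
    | cons a s ih =>
      intro x hx
      refine ih x (hT a _ ?_)
      simpa [Module.algebraMap_end_apply] using hx
  have hs := (IsAlgClosed.splits p).eq_prod_roots
  refine key p.roots x ?_
  rw [hs, map_mul, Polynomial.aeval_C, Module.End.mul_apply, Module.algebraMap_end_apply] at hx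
  simpa [hp] using M.smul_mem p.leadingCoeff⁻¹ hx

variable {A : Type*} [CommGroup A]

/-- A submodule maximal among the invariant submodules not containing a given vector. -/
theorem exists_maximal_invariant_not_mem (ρ : Representation ℂ A V) {w : V} (hw : w ≠ 0) :
    ∃ M : Submodule ℂ V, Maximal
      (fun M : Submodule ℂ V => (∀ a, ∀ x ∈ M, ρ a x ∈ M) ∧ w ∉ M) M := by
  refine (zorn_le_nonempty₀ {M : Submodule ℂ V | (∀ a, ∀ x ∈ M, ρ a x ∈ M) ∧ w ∉ M} ?_ ⊥
    ⟨by simp, by simpa using hw⟩).imp fun M hM => hM.2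
  intro c hc hchain N hN
  have hmem {x : V} : x ∈ sSup c ↔ ∃ M ∈ c, x ∈ M :=
    Submodule.mem_sSup_of_directed ⟨N, hN⟩ hchain.directedOn
  refine ⟨sSup c, ⟨fun a x hx => ?_, fun h => ?_⟩, fun M hM => le_sSup hM⟩
  · obtain ⟨M, hM, hxM⟩ := hmem.mp hx
    exact hmem.mpr ⟨M, hM, (hc hM).1 a x hxM⟩
  · obtain ⟨M, hM, hwM⟩ := hmem.mp h
    exact (hc hM).2 hwM

/-- In a representation of an abelian group whose elements act on each vector with finite order,
a nonzero vector is detected by an equivariant functional into a one-dimensional representation.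
On the quotient by a submodule `M` maximal among the invariant submodules not containing `w`, every
group element acts by a scalar: any nonzero invariant submodule of `V / M` contains the image of
`w`, so two different eigenvalues of one element are impossible. -/
theorem exists_equivariant_functional (ρ : Representation ℂ A V)
    (hfin : ∀ (a : A) (x : V), ∃ n : ℕ, 0 < n ∧ (ρ a ^ n) x = x) {w : V} (hw : w ≠ 0) :
    ∃ (χ : A → ℂ) (l : V →ₗ[ℂ] ℂ), l w ≠ 0 ∧ ∀ a x, l (ρ a x) = χ a * l x := by
  obtain ⟨M, ⟨hM, hwM⟩, hmax⟩ := exists_maximal_invariant_not_mem ρ hw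
  have hcomm (a b : A) (x : V) : ρ a (ρ b x) = ρ b (ρ a x) := by
    rw [← Module.End.mul_apply, ← Module.End.mul_apply, ← map_mul, ← map_mul, mul_comm]
  -- The preimage of `M` under an operator commuting with `A` is `M` unless it contains `w`.
  have hcomap (S : Module.End ℂ V) (hS : ∀ a x, S (ρ a x) = ρ a (S x))
      (hSM : ∀ x ∈ M, S x ∈ M) (hSw : S w ∉ M) (x : V) (hx : S x ∈ M) : x ∈ M :=
    hmax (y := M.comap S) ⟨fun a x hx => by
      rw [Submodule.mem_comap, hS]; exact hM a _ hx, hSw⟩ hSM hx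
  have hscalar : ∀ a : A, ∃ ζ : ℂ, ∀ x, ρ a x - ζ • x ∈ M := by
    intro a
    have hζ : ∃ ζ : ℂ, ρ a w - ζ • w ∈ M := by
      by_contra! h
      obtain ⟨n, hn, hnw⟩ := hfin a w
      refine hwM (mem_of_aeval_apply_mem (T := ρ a) (fun ζ x hx => ?_)
        (Polynomial.X_pow_sub_C_ne_zero hn 1) (x := w) (by simp [hnw]))
      refine hcomap (ρ a - ζ • 1) (fun b y => ?_) (fun y hy => ?_) (h ζ) x hx
      · simp [hcomm a b]
      · exact M.sub_mem (hM a y hy) (M.smul_mem ζ hy)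
    obtain ⟨ζ, hζ⟩ := hζ
    refine ⟨ζ, fun x => ?_⟩
    obtain ⟨n, hn, hnx⟩ : ∃ n : ℕ, 0 < n ∧ (ρ a ^ n) x = x ∧ (ρ a ^ n) w = w := by
      obtain ⟨m, hm, hmx⟩ := hfin a x
      obtain ⟨n, hn, hnw⟩ := hfin a w
      refine ⟨m * n, Nat.mul_pos hm hn, ?_, ?_⟩
      · rw [pow_mul, Module.End.pow_apply]
        exact Function.iterate_fixed hmx n
      · rw [mul_comm, pow_mul, Module.End.pow_apply]
        exact Function.iterate_fixed hnw m
    have hpow (i : ℕ) : (ρ a ^ i) w - ζ ^ i • w ∈ M := by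
      induction i with
      | zero => simp
      | succ i ih =>
        have : (ρ a ^ (i + 1)) w - ζ ^ (i + 1) • w =
            ρ a ((ρ a ^ i) w - ζ ^ i • w) + ζ ^ i • (ρ a w - ζ • w) := by
          rw [pow_succ' (ρ a), Module.End.mul_apply, map_sub, map_smul, smul_sub, smul_smul,
            pow_succ ζ]
          abel
        rw [this]
        exact M.add_mem (hM a _ ih) (M.smul_mem _ hζ)
    have hζn : ζ ^ n = 1 := by
      by_contra hne
      have h1 : (1 - ζ ^ n) • w ∈ M := by
        have := hpow n
        rwa [hnx.2, ← one_smul ℂ w, smul_smul, mul_one, ← sub_smul] at this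
      have := M.smul_mem (1 - ζ ^ n)⁻¹ h1
      rw [smul_smul, inv_mul_cancel₀ (sub_ne_zero.mpr (Ne.symm hne)), one_smul] at this
      exact hwM this
    -- The operator `(Tⁿ - ζⁿ) / (T - ζ)` kills the image of `T - ζ`, and is `n ζⁿ⁻¹ ≠ 0` on `w`.
    set E : Module.End ℂ V := ∑ i ∈ Finset.range n, ρ a ^ i * (ζ • 1) ^ (n - 1 - i) with hE
    have hEapp (y : V) : E y = ∑ i ∈ Finset.range n, ζ ^ (n - 1 - i) • (ρ a ^ i) y := by
      simp [hE, LinearMap.sum_apply, smul_pow]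
    have hgeom : E * (ρ a - ζ • 1) = ρ a ^ n - (ζ • 1) ^ n :=
      Commute.geom_sum₂_mul (by simp [Commute, SemiconjBy]) n
    have hpowM (i : ℕ) {y : V} (hy : y ∈ M) : (ρ a ^ i) y ∈ M := by
      rw [← map_pow]; exact hM _ y hy
    refine hcomap E (fun b y => ?_) (fun y hy => ?_) (fun hEw => ?_) _ ?_
    · rw [hEapp, hEapp, map_sum]
      refine Finset.sum_congr rfl fun i _ => ?_
      rw [map_smul, ← map_pow, hcomm]
    · rw [hEapp]
      exact M.sum_mem fun i _ => M.smul_mem _ (hpowM i hy)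
    · have h1 : E w - (n * ζ ^ (n - 1)) • w ∈ M := by
        have : E w - ((n : ℂ) * ζ ^ (n - 1)) • w =
            ∑ i ∈ Finset.range n, ζ ^ (n - 1 - i) • ((ρ a ^ i) w - ζ ^ i • w) := by
          rw [hEapp]
          simp only [smul_sub, Finset.sum_sub_distrib, smul_smul, ← pow_add]
          congr 1
          rw [Finset.sum_congr rfl (g := fun _ => ζ ^ (n - 1) • w)]
          · rw [Finset.sum_const, Finset.card_range, ← Nat.cast_smul_eq_nsmul ℂ, smul_smul]
          · intro i hi
            rw [Nat.sub_add_cancel (by have := Finset.mem_range.mp hi; omega)]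
        rw [this]
        exact M.sum_mem fun i _ => M.smul_mem _ (hpow i)
      have h2 : ((n : ℂ) * ζ ^ (n - 1)) • w ∈ M := by
        have := M.sub_mem hEw h1
        rwa [sub_sub_cancel] at this
      have hne : (n : ℂ) * ζ ^ (n - 1) ≠ 0 := by
        refine mul_ne_zero (by exact_mod_cast hn.ne') (pow_ne_zero _ ?_)
        rintro rfl
        simp [hn.ne'] at hζn
      have := M.smul_mem ((n : ℂ) * ζ ^ (n - 1))⁻¹ h2
      rw [smul_smul, inv_mul_cancel₀ hne, one_smul] at this
      exact hwM this
    · have : E (ρ a x - ζ • x) = 0 := by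
        have := LinearMap.congr_fun hgeom x
        simpa [smul_pow, hζn, hnx.1] using this
      rw [this]
      exact M.zero_mem
  choose χ hχ using hscalar
  obtain ⟨f, hf⟩ : ∃ f : (V ⧸ M) →ₗ[ℂ] ℂ, f (M.mkQ w) ≠ 0 := by
    by_contra! h
    exact hwM ((Submodule.Quotient.mk_eq_zero M).mp
      ((Module.forall_dual_apply_eq_zero_iff ℂ (M.mkQ w)).mp h))
  refine ⟨χ, f ∘ₗ M.mkQ, hf, fun a x => ?_⟩
  have : M.mkQ (ρ a x - χ a • x) = 0 := (Submodule.Quotient.mk_eq_zero M).mpr (hχ a x)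
  rw [map_sub, sub_eq_zero, map_smul] at this
  simp only [LinearMap.comp_apply]
  rw [this, map_smul, smul_eq_mul]

/-! ### Schur's lemma in countable dimension -/

/-- On a nonzero complex vector space spanned by countably many vectors, some `T - ζ` is not
bijective: otherwise the uncountably many vectors `(T - ζ)⁻¹ v` would be linearly independent. -/
theorem exists_not_bijective_sub_smul {s : Set V} (hs : s.Countable)
    (hspan : Submodule.span ℂ s = ⊤) {v : V} (hv : v ≠ 0) (T : Module.End ℂ V) :
    ∃ ζ : ℂ, ¬ Function.Bijective (T - ζ • 1 : Module.End ℂ V) := by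
  by_contra! h
  choose u hu using fun ζ : ℂ => (h ζ).2 v
  have hpoly {p : Polynomial ℂ} (hp : p ≠ 0) {x : V} (hx : Polynomial.aeval T p x = 0) : x = 0 :=
    mem_of_aeval_apply_mem (M := ⊥) (fun ζ x hx =>
      (map_eq_zero_iff (T - ζ • 1 : Module.End ℂ V) (h ζ).1).mp (by simpa using hx)) hp hx
  have hli : LinearIndependent ℂ u := by
    rw [linearIndependent_iff']
    intro t g hg a ha
    -- Clearing denominators turns a relation into a polynomial in `T` that kills `v`.
    set q : Polynomial ℂ := ∑ b ∈ t, Polynomial.C (g b) *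
      ∏ c ∈ t.erase b, (Polynomial.X - Polynomial.C c) with hq
    have hqv : Polynomial.aeval T q v = 0 := by
      have h1 (b : ℂ) (hb : b ∈ t) : Polynomial.aeval T (∏ c ∈ t, (Polynomial.X - Polynomial.C c))
          (u b) = Polynomial.aeval T (∏ c ∈ t.erase b, (Polynomial.X - Polynomial.C c)) v := by
        rw [← Finset.prod_erase_mul _ _ hb, map_mul, Module.End.mul_apply]
        congr 1
        rw [← hu b]
        simp [Module.algebraMap_end_apply]
      have h2 := congrArg (Polynomial.aeval T (∏ c ∈ t, (Polynomial.X - Polynomial.C c))) hg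
      rw [map_sum, map_zero] at h2
      rw [← h2, hq, map_sum, LinearMap.sum_apply]
      refine Finset.sum_congr rfl fun b hb => ?_
      rw [map_smul, h1 b hb, map_mul, Module.End.mul_apply, Polynomial.aeval_C,
        Module.algebraMap_end_apply]
    have hq0 : q = 0 := by
      by_contra hq0
      exact hv (hpoly hq0 hqv)
    have h3 := congrArg (Polynomial.eval a) hq0
    rw [hq, Polynomial.eval_finsetSum, Finset.sum_eq_single a] at h3
    · simp only [Polynomial.eval_mul, Polynomial.eval_C, Polynomial.eval_prod, Polynomial.eval_sub,
        Polynomial.eval_X, Polynomial.eval_zero] at h3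
      refine (mul_eq_zero.mp h3).resolve_right (Finset.prod_ne_zero_iff.mpr fun c hc => ?_)
      exact sub_ne_zero.mpr (Finset.ne_of_mem_erase hc).symm
    · intro b hb hba
      rw [Polynomial.eval_mul, Polynomial.eval_prod,
        Finset.prod_eq_zero (Finset.mem_erase.mpr ⟨hba.symm, ha⟩) (by simp), mul_zero]
    · exact fun h => absurd ha h
  have h1 := hli.cardinal_lift_le_rank
  have h2 : Module.rank ℂ V ≤ Cardinal.aleph0 := by
    rw [← rank_top, ← hspan]
    exact (rank_span_le s).trans hs.le_aleph0
  have h3 := h1.trans (Cardinal.lift_le.mpr h2)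
  rw [Cardinal.mk_complex, Cardinal.lift_continuum, Cardinal.lift_aleph0] at h3
  exact absurd h3 (not_le.mpr Cardinal.aleph0_lt_continuum)

/-- An irreducible representation by commuting operators with countable orbits is
one-dimensional. -/
theorem finrank_eq_one_of_commute {G : Type*} [Group G] (π : Representation ℂ G V)
    (hirr : π.IsIrreducible) (hcomm : ∀ g h, Commute (π g) (π h))
    (hcount : ∀ v, (Set.range fun g => π g v).Countable) : Module.finrank ℂ V = 1 := by
  have hsub (S : Submodule ℂ V) (hS : ∀ g, ∀ x ∈ S, π g x ∈ S) : S = ⊥ ∨ S = ⊤ := by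
    rcases hirr.eq_bot_or_eq_top ⟨S, fun g x hx => hS g x hx⟩ with h | h
    · exact Or.inl (congrArg Subrepresentation.toSubmodule h)
    · exact Or.inr (congrArg Subrepresentation.toSubmodule h)
  obtain ⟨v, hv⟩ : ∃ v : V, v ≠ 0 := by
    by_contra! h
    have := hirr.toNontrivial
    refine bot_ne_top (α := Subrepresentation π) (Subrepresentation.toSubmodule_injective ?_)
    ext x
    rw [h x]
    exact ⟨fun _ => Submodule.zero_mem _, fun _ => Submodule.zero_mem _⟩
  have hspan : Submodule.span ℂ (Set.range fun g => π g v) = ⊤ := by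
    refine (hsub _ fun g x hx => ?_).resolve_left fun h => hv ?_
    · refine Submodule.span_induction (p := fun x _ => π g x ∈ _) ?_ (by simp) ?_ ?_ hx
      · rintro _ ⟨h, rfl⟩
        exact Submodule.subset_span ⟨g * h, by simp⟩
      · intro x y _ _ hx hy
        rw [map_add]
        exact Submodule.add_mem _ hx hy
      · intro a x _ hx
        rw [map_smul]
        exact Submodule.smul_mem _ a hx
    · rw [← Submodule.mem_bot ℂ, ← h]
      exact Submodule.subset_span ⟨1, by simp⟩
  have hscalar (g : G) : ∃ ζ : ℂ, π g = ζ • 1 := by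
    obtain ⟨ζ, hζ⟩ := exists_not_bijective_sub_smul (hcount v) hspan hv (π g)
    refine ⟨ζ, ?_⟩
    have hc (h : G) (x : V) : (π g - ζ • 1 : Module.End ℂ V) (π h x) =
        π h ((π g - ζ • 1 : Module.End ℂ V) x) := by
      have := LinearMap.congr_fun (hcomm g h).eq x
      simp only [Module.End.mul_apply] at this
      simp [this]
    rw [← sub_eq_zero]
    rcases hsub (LinearMap.range (π g - ζ • 1 : Module.End ℂ V)) (by
      rintro h _ ⟨x, rfl⟩
      exact ⟨π h x, hc h x⟩) with h1 | h1
    · exact LinearMap.range_eq_bot.mp h1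
    rcases hsub (LinearMap.ker (π g - ζ • 1 : Module.End ℂ V)) (by
      intro h x hx
      rw [LinearMap.mem_ker] at hx ⊢
      rw [hc, hx, map_zero]) with h2 | h2
    · exact absurd ⟨LinearMap.ker_eq_bot.mp h2, LinearMap.range_eq_top.mp h1⟩ hζ
    · exact LinearMap.ker_eq_top.mp h2
  refine finrank_eq_one_iff_of_nonzero v hv |>.mpr ?_
  refine (hsub _ fun g x hx => ?_).resolve_left fun h => hv (by simpa using h)
  obtain ⟨ζ, hζ⟩ := hscalar g
  rw [hζ]
  exact Submodule.smul_mem _ ζ hx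

end LinearAlgebra
end FourierJacobi

namespace FourierJacobi

/-! ### Additive characters of a local field -/

/-- A group of characters of a finite abelian group that separates points contains every
character. -/
theorem addChar_eq_top_of_separates {A : Type*} [AddCommGroup A] [Finite A]
    (S : AddSubgroup (AddChar A ℂ)) (hS : ∀ a, (∀ s ∈ S, s a = 1) → a = 0) : S = ⊤ := by
  cases nonempty_fintype A
  -- Evaluation embeds `A` into the dual of `S`, so `S` has at least as many elements as `A`.
  let f (a : A) : AddChar S ℂ :=
    { toFun := fun s => s.1 a
      map_zero_eq_one' := by simp
      map_add_eq_mul' := fun s t => by simp [AddChar.add_apply] }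
  have hf : Function.Injective f := by
    intro a b hab
    rw [← sub_eq_zero]
    refine hS _ fun s hs => ?_
    have : s a = s b := congrArg (fun φ : AddChar S ℂ => φ ⟨s, hs⟩) hab
    rw [AddChar.map_sub_eq_div, this, div_self (AddChar.val_isUnit s b).ne_zero]
  cases nonempty_fintype S
  refine AddSubgroup.eq_top_of_le_card S ?_
  have h1 := Nat.card_le_card_of_injective f hf
  rw [Nat.card_eq_fintype_card (α := AddChar S ℂ), AddChar.card_eq] at h1
  rw [Nat.card_eq_fintype_card (α := AddChar A ℂ), AddChar.card_eq, ← Nat.card_eq_fintype_card]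
  rwa [← Nat.card_eq_fintype_card] at h1

/-- The character induced on `K ⧸ L` by a character trivial on `L`. -/
def descendChar {B : Type*} [AddCommGroup B] (K L : AddSubgroup B) (φ : AddChar B ℂ)
    (h : ∀ x ∈ L, φ x = 1) : AddChar (K ⧸ L.addSubgroupOf K) ℂ :=
  AddChar.toAddMonoidHomEquiv.symm
    (QuotientAddGroup.lift _ (AddChar.toAddMonoidHomEquiv (φ.compAddMonoidHom K.subtype))
      fun x hx => h x (AddSubgroup.mem_addSubgroupOf.mp hx))

theorem descendChar_mk {B : Type*} [AddCommGroup B] (K L : AddSubgroup B) (φ : AddChar B ℂ)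
    (h : ∀ x ∈ L, φ x = 1) (x : K) :
    descendChar K L φ h (QuotientAddGroup.mk x) = φ x := rfl

/-- A power `zⁿ` cannot stay within distance `1 / 2` of `1` for all `n` unless `z = 1`: squaring
multiplies the distance to `1` by at least `3 / 2`. -/
theorem eq_one_of_forall_norm_pow_sub_one_le {z : ℂ} (hz : ∀ n : ℕ, ‖z ^ n - 1‖ ≤ 1 / 2) :
    z = 1 := by
  have h (n : ℕ) : (3 / 2) ^ n * ‖z - 1‖ ≤ ‖z ^ 2 ^ n - 1‖ := by
    induction n with
    | zero => simp
    | succ n ih =>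
      have h1 : z ^ 2 ^ (n + 1) - 1 = (z ^ 2 ^ n - 1) * (z ^ 2 ^ n + 1) := by ring
      have h2 : (3 / 2 : ℝ) ≤ ‖z ^ 2 ^ n + 1‖ := by
        have h3 : ‖(2 : ℂ)‖ ≤ ‖z ^ 2 ^ n + 1‖ + ‖z ^ 2 ^ n - 1‖ := by
          refine le_of_eq_of_le ?_ (norm_sub_le _ _)
          congr 1
          ring
        rw [Complex.norm_ofNat] at h3
        linarith [hz (2 ^ n)]
      rw [h1, norm_mul, pow_succ]
      nlinarith [norm_nonneg (z ^ 2 ^ n - 1), norm_nonneg (z - 1)]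
  by_contra hne
  have hpos : 0 < ‖z - 1‖ := norm_pos_iff.mpr (sub_ne_zero.mpr hne)
  obtain ⟨n, hn⟩ := pow_unbounded_of_one_lt (1 / ‖z - 1‖) (by norm_num : (1 : ℝ) < 3 / 2)
  rw [div_lt_iff₀ hpos] at hn
  linarith [h n, hz (2 ^ n)]

section LocalField

open ValuativeRel

variable {k : Type*} [Field k] [ValuativeRel k]

variable (k) in
/-- The closed ball of radius `γ` around `0`, as an additive subgroup. -/
def ballSubgroup (γ : ValueGroupWithZero k) : AddSubgroup k where
  carrier := {x | valuation k x ≤ γ}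
  zero_mem' := by simp
  add_mem' hx hy := (valuation k).map_add_le hx hy
  neg_mem' hx := by simpa [Valuation.map_neg] using hx

theorem mem_ballSubgroup {γ : ValueGroupWithZero k} {x : k} :
    x ∈ ballSubgroup k γ ↔ valuation k x ≤ γ := Iff.rfl

variable [TopologicalSpace k] [IsNonarchimedeanLocalField k]

/-- Every neighbourhood of `0` contains a closed ball of nonzero radius. -/
theorem exists_ball_subset {U : Set k} (hU : U ∈ nhds 0) :
    ∃ r : k, r ≠ 0 ∧ ∀ x, valuation k x ≤ valuation k r → x ∈ U := by
  obtain ⟨γ, hγ, h⟩ := (IsValuativeTopology.hasBasis_nhds_zero' k).mem_iff.mp hU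
  obtain ⟨s, rfl⟩ := ValuativeRel.valuation_surjective γ
  obtain ⟨t, ht, ht1⟩ := Valuation.IsNontrivial.exists_lt_one (v := valuation k)
  have ht0 : t ≠ 0 := by rintro rfl; simp at ht
  have hs0 : s ≠ 0 := by rintro rfl; simp at hγ
  refine ⟨s * t, mul_ne_zero hs0 ht0, fun x hx => h ?_⟩
  refine lt_of_le_of_lt hx ?_
  rw [map_mul]
  exact mul_lt_of_lt_one_right (zero_lt_iff.mpr hγ) ht1

theorem isOpen_ballSubgroup {r : k} (hr : r ≠ 0) :
    IsOpen (ballSubgroup k (valuation k r) : Set k) := by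
  refine AddSubgroup.isOpen_of_mem_nhds _ (g := 0) ?_
  refine (IsValuativeTopology.hasBasis_nhds_zero' k).mem_iff.mpr
    ⟨valuation k r, by simpa using hr, fun x hx => mem_ballSubgroup.mpr (le_of_lt hx)⟩

instance compactSpace_ballSubgroup (γ : ValueGroupWithZero k) :
    CompactSpace (ballSubgroup k γ) :=
  isCompact_iff_compactSpace.mp (IsNonarchimedeanLocalField.isCompact_closedBall k γ)

theorem finite_ball_quotient (γ : ValueGroupWithZero k) {L : AddSubgroup k}
    (hL : IsOpen (L : Set k)) : Finite (ballSubgroup k γ ⧸ L.addSubgroupOf (ballSubgroup k γ)) :=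
  AddSubgroup.quotient_finite_of_isOpen _ (hL.preimage continuous_subtype_val)

/-- A local field is a torsion group modulo any open subgroup. -/
theorem exists_nsmul_mem {L : AddSubgroup k} (hL : IsOpen (L : Set k)) (x : k) :
    ∃ n : ℕ, 0 < n ∧ n • x ∈ L := by
  have := finite_ball_quotient (valuation k x) hL
  obtain ⟨n, hn, -, h⟩ := AddSubgroup.exists_nsmul_mem_of_index_ne_zero
    (H := L.addSubgroupOf (ballSubgroup k (valuation k x)))
    AddSubgroup.index_ne_zero_of_finite ⟨x, mem_ballSubgroup.mpr le_rfl⟩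
  exact ⟨n, hn, AddSubgroup.mem_addSubgroupOf.mp h⟩

instance t2Space_of_isNonarchimedeanLocalField : T2Space k :=
  IsTopologicalAddGroup.t2Space_of_zero_sep fun x hx =>
    ⟨{y | valuation k y < valuation k x},
      (IsValuativeTopology.hasBasis_nhds_zero' k).mem_of_mem (by simpa using hx), by simp⟩

instance sigmaCompactSpace_of_isNonarchimedeanLocalField : SigmaCompactSpace k := by
  have : Countable (ValueGroupWithZero k) :=
    have : Countable (WithZero (Multiplicative ℤ)) :=
      inferInstanceAs (Countable (Option ℤ))
    (IsNonarchimedeanLocalField.valueGroupWithZeroIsoInt k).injective.countable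
  have h := isSigmaCompact_iUnion_of_isCompact (fun γ : ValueGroupWithZero k =>
    {x : k | valuation k x ≤ γ}) fun γ => IsNonarchimedeanLocalField.isCompact_closedBall k γ
  rw [Set.iUnion_eq_univ_iff.mpr fun x => ⟨valuation k x, le_refl (valuation k x)⟩] at h
  exact isSigmaCompact_univ_iff.mp h

instance sigmaCompactSpace_units : SigmaCompactSpace kˣ :=
  have : SigmaCompactSpace kᵐᵒᵖ := MulOpposite.opHomeomorph.symm.isClosedEmbedding.sigmaCompactSpace
  Units.isClosedEmbedding_embedProduct.sigmaCompactSpace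

theorem exists_ball_apply_eq_one {χ : AddChar k ℂ} (hχ : Continuous χ) :
    ∃ r : k, r ≠ 0 ∧ ∀ x, valuation k x ≤ valuation k r → χ x = 1 := by
  have hU : χ ⁻¹' Metric.closedBall 1 (1 / 2) ∈ nhds (0 : k) := by
    refine hχ.continuousAt.preimage_mem_nhds ?_
    rw [AddChar.map_zero_eq_one]
    exact Metric.closedBall_mem_nhds _ (by norm_num)
  obtain ⟨r, hr, h⟩ := exists_ball_subset hU
  refine ⟨r, hr, fun x hx => eq_one_of_forall_norm_pow_sub_one_le fun n => ?_⟩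
  have hn : n • x ∈ ballSubgroup k (valuation k r) := AddSubgroup.nsmul_mem _ hx n
  have := h _ hn
  rwa [Set.mem_preimage, AddChar.map_nsmul_eq_pow, mem_closedBall_iff_norm] at this

/-- A nontrivial continuous character has an element of least valuation outside its kernel. -/
theorem exists_minimal_apply_ne_one {χ : AddChar k ℂ} (hχ : Continuous χ) (hχ1 : χ ≠ 1) :
    ∃ y : k, χ y ≠ 1 ∧ ∀ z, valuation k z < valuation k y → χ z = 1 := by
  obtain ⟨r, hr, hr1⟩ := exists_ball_apply_eq_one hχ
  let e := IsNonarchimedeanLocalField.valueGroupWithZeroIsoInt k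
  have he {x : k} (hx : x ≠ 0) : e (valuation k x) ≠ 0 := by simpa using hx
  have hlog {x y : k} (hx : x ≠ 0) (hy : y ≠ 0) :
      (e (valuation k x)).log < (e (valuation k y)).log ↔ valuation k x < valuation k y := by
    rw [WithZero.log_lt_log (he hx) (he hy)]
    exact e.strictMono.lt_iff_lt
  have hne {y : k} (hy : χ y ≠ 1) : y ≠ 0 := by rintro rfl; simp at hy
  obtain ⟨_, ⟨y, hy, rfl⟩, hmin⟩ := Int.exists_least_of_bdd
    (P := fun n => ∃ y, χ y ≠ 1 ∧ (e (valuation k y)).log = n)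
    ⟨(e (valuation k r)).log, by
      rintro _ ⟨y, hy, rfl⟩
      rw [← not_lt, hlog (hne hy) hr]
      exact fun h => hy (hr1 y h.le)⟩
    (by
      by_contra! h
      refine hχ1 (DFunLike.ext _ _ fun y => ?_)
      by_contra hy
      exact h _ y hy rfl)
  refine ⟨y, hy, fun z hz => ?_⟩
  by_contra hz1
  exact absurd (hmin _ ⟨z, hz1, rfl⟩) (not_le.mpr ((hlog (hne hz1) (hne hy)).mpr hz))

/-- On a ball, every continuous character is a multiplicative shift of a given nontrivial one:
modulo a small ball the shifts of `χ` form a group of characters that separates points. -/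
theorem exists_mul_eq_on_ball {χ ψ : AddChar k ℂ} (hχ : Continuous χ) (hχ1 : χ ≠ 1)
    (hψ : Continuous ψ) (γ : ValueGroupWithZero k) :
    ∃ c : k, ∀ x, valuation k x ≤ γ → ψ x = χ (c * x) := by
  obtain ⟨y, hy, hmin⟩ := exists_minimal_apply_ne_one hχ hχ1
  obtain ⟨r, hr, hr1⟩ := exists_ball_apply_eq_one hψ
  set K := ballSubgroup k γ
  set L := ballSubgroup k (valuation k r)
  have := finite_ball_quotient γ (isOpen_ballSubgroup hr)
  let S : AddSubgroup (AddChar (K ⧸ L.addSubgroupOf K) ℂ) :=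
    { carrier := {θ | ∃ c : k, ∀ x : K, θ (QuotientAddGroup.mk x) = χ (c * x)}
      zero_mem' := ⟨0, fun x => by simp⟩
      add_mem' := by
        rintro θ η ⟨c, hc⟩ ⟨d, hd⟩
        exact ⟨c + d, fun x => by rw [AddChar.add_apply, hc, hd, add_mul, AddChar.map_add_eq_mul]⟩
      neg_mem' := by
        rintro θ ⟨c, hc⟩
        exact ⟨-c, fun x => by
          rw [AddChar.neg_apply, ← QuotientAddGroup.mk_neg, hc]
          simp⟩ }
  have hS : S = ⊤ := by
    refine addChar_eq_top_of_separates S fun a ha => ?_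
    induction a using QuotientAddGroup.induction_on with
    | H x =>
      rw [QuotientAddGroup.eq_zero_iff, AddSubgroup.mem_addSubgroupOf]
      by_contra hx
      have hlt : valuation k r < valuation k (x : k) := not_le.mp hx
      have hx0 : (x : k) ≠ 0 := by
        intro h0
        simp [h0] at hlt
      -- The shift by `y / x` is trivial on `L` and takes the value `χ y ≠ 1` at `x`.
      have hL : ∀ z ∈ L, χ.mulShift (y / x) z = 1 := by
        intro z hz
        rw [AddChar.mulShift_apply]
        refine hmin _ ?_
        have hy0 : y ≠ 0 := by rintro rfl; simp at hy
        rw [map_mul, map_div₀, div_mul_eq_mul_div, div_lt_iff₀ (by simpa [zero_lt_iff] using hx0)]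
        exact mul_lt_mul_of_pos_left (lt_of_le_of_lt hz hlt) (by simpa [zero_lt_iff] using hy0)
      have := ha (descendChar K L _ hL) ⟨y / x, fun z => by
        rw [descendChar_mk, AddChar.mulShift_apply]⟩
      rw [descendChar_mk, AddChar.mulShift_apply, div_mul_cancel₀ _ hx0] at this
      exact hy this
  obtain ⟨c, hc⟩ : descendChar K L ψ hr1 ∈ S := hS ▸ AddSubgroup.mem_top _
  exact ⟨c, fun x hx => hc ⟨x, hx⟩⟩

/-- A nontrivial continuous character `χ` of a local field generates its dual: every continuous
character is of the form `x ↦ χ (c x)`. The scalars `c` that work on larger and larger balls lie in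
a compact set. -/
theorem exists_forall_eq_mul {χ ψ : AddChar k ℂ} (hχ : Continuous χ) (hχ1 : χ ≠ 1)
    (hψ : Continuous ψ) : ∃ c : k, ∀ x, ψ x = χ (c * x) := by
  obtain ⟨y, hy, hmin⟩ := exists_minimal_apply_ne_one hχ hχ1
  obtain ⟨c₁, hc₁⟩ := exists_mul_eq_on_ball hχ hχ1 hψ 1
  have hcompact : IsCompact {c : k | valuation k (c - c₁) ≤ valuation k y} :=
    (Homeomorph.subRight c₁).isCompact_preimage.mpr
      (IsNonarchimedeanLocalField.isCompact_closedBall k (valuation k y))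
  obtain ⟨c, -, hc⟩ := hcompact.inter_iInter_nonempty (fun x => {c : k | ψ x = χ (c * x)})
    (fun x => isClosed_eq continuous_const (hχ.comp (continuous_mul_const x))) (by
      classical
      intro u
      obtain ⟨γ, hγ⟩ := (insert 1 (u.image (valuation k))).exists_le
      obtain ⟨c, hc⟩ := exists_mul_eq_on_ball hχ hχ1 hψ γ
      refine ⟨c, ?_, Set.mem_iInter₂.mpr fun x hx => hc x (hγ _
        (Finset.mem_insert_of_mem (Finset.mem_image_of_mem _ hx)))⟩
      -- As `c` and `c₁` both work on the unit ball, `χ` is trivial on `(c - c₁) 𝒪`.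
      by_contra hlt
      have hlt : valuation k y < valuation k (c - c₁) := not_le.mp hlt
      have hd : c - c₁ ≠ 0 := by
        intro h0
        simp [h0] at hlt
      have hle : valuation k (y / (c - c₁)) ≤ 1 := by
        rw [map_div₀]
        exact div_le_one_of_le₀ hlt.le zero_le
      have h1 := hc₁ _ hle
      rw [hc _ (hle.trans (hγ _ (Finset.mem_insert_self _ _)))] at h1
      apply hy
      have h2 : y = c * (y / (c - c₁)) - c₁ * (y / (c - c₁)) := by field_simp
      rw [h2, AddChar.map_sub_eq_div, h1, div_self (AddChar.val_isUnit χ _).ne_zero])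
  exact ⟨c, fun x => Set.mem_iInter.mp hc x⟩

/-! ### Continuity of the one-parameter subgroups -/

theorem continuous_heis_zero_zero : Continuous fun z : k => heis 0 0 z := by
  have h (f : k → k) (hf : Continuous f) : Continuous fun z => heisMatrix 0 0 (f z) := by
    refine continuous_matrix fun i j => ?_
    fin_cases i <;> fin_cases j <;> simp [heisMatrix] <;> fun_prop
  refine Continuous.subtype_mk (Units.continuous_iff.mpr ⟨h _ continuous_id, ?_⟩) _
  change Continuous fun z : k => heisMatrix (-0) (-0) (-z)
  rw [neg_zero]
  exact h _ continuous_neg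

theorem continuous_torus : Continuous (torus : kˣ → GSp4 k) := by
  have h (f : kˣ → k) (hf : Continuous f) :
      Continuous fun c => Matrix.diagonal ![1, 1, f c, f c] := by
    refine Continuous.matrix_diagonal (continuous_pi fun i => ?_)
    fin_cases i <;> simp <;> fun_prop
  exact Continuous.subtype_mk (Units.continuous_iff.mpr
    ⟨h _ Units.continuous_val, h _ (Units.continuous_val.comp continuous_inv)⟩) _

end LocalField
end FourierJacobi

namespace FourierJacobi

/-! ### Smooth representations of `GSp(4)` -/

theorem IsSmooth.isOpen_apply_eq {G V : Type*} [Group G] [TopologicalSpace G]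
    [IsTopologicalGroup G] [AddCommGroup V] [Module ℂ V] {π : Representation ℂ G V}
    (hπ : IsSmooth π) (v w : V) : IsOpen {g : G | π g v = w} := by
  by_cases h : ∃ g₀, π g₀ v = w
  · obtain ⟨g₀, rfl⟩ := h
    have : {g : G | π g v = π g₀ v} = (g₀⁻¹ * ·) ⁻¹' {g : G | π g v = v} := by
      ext g
      simp only [Set.mem_ofPred_eq, Set.mem_preimage, map_mul, Module.End.mul_apply]
      constructor
      · intro h
        rw [h, ← Module.End.mul_apply, ← map_mul, inv_mul_cancel, map_one, Module.End.one_apply]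
      · intro h
        conv_rhs => rw [← h]
        rw [← Module.End.mul_apply, ← map_mul, mul_inv_cancel, map_one, Module.End.one_apply]
    rw [this]
    exact (hπ v).preimage (continuous_const_mul _)
  · push Not at h
    convert! isOpen_empty
    ext g
    simpa using h g

section LocalField

variable {k : Type*} [Field k] [ValuativeRel k] [TopologicalSpace k]
  [IsNonarchimedeanLocalField k] {V : Type*} [AddCommGroup V] [Module ℂ V]
  {π : Representation ℂ (GSp4 k) V}

/-- The torus `kˣ` is a countable union of compact sets, so its orbits in a smooth representation
are countable. -/
theorem IsSmooth.countable_range_torus (hπ : IsSmooth π) (v : V) :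
    (Set.range fun c : kˣ => π (torus c) v).Countable := by
  let _ : TopologicalSpace V := ⊥
  have : DiscreteTopology V := ⟨rfl⟩
  have hcont : Continuous fun c : kˣ => π (torus c) v :=
    continuous_discrete_rng.mpr fun w => (hπ.isOpen_apply_eq v w).preimage continuous_torus
  rw [← Set.image_univ]
  exact (isLindelof_univ.image hcont).countable_of_discrete

/-- A smooth irreducible representation on which `Z` acts trivially is one-dimensional: it factors
through the similitude character. -/
theorem finrank_eq_one_of_heis_mem_ker (hirr : π.IsIrreducible) (hπ : IsSmooth π)
    (hZ : ∀ z : k, heis 0 0 z ∈ MonoidHom.ker π) : Module.finrank ℂ V = 1 := by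
  have key (g : GSp4 k) : ∃ c : kˣ, π g = π (torus c) := by
    obtain ⟨n, hn, c, rfl⟩ := exists_mem_mul_torus hZ g
    exact ⟨c, by rw [map_mul, MonoidHom.mem_ker.mp hn, one_mul]⟩
  refine finrank_eq_one_of_commute π hirr (fun g h => ?_) fun v => ?_
  · obtain ⟨c, hc⟩ := key g
    obtain ⟨d, hd⟩ := key h
    rw [hc, hd]
    exact (Commute.all c d).map (π.comp torus)
  · refine (hπ.countable_range_torus v).mono ?_
    rintro _ ⟨g, rfl⟩
    obtain ⟨c, hc⟩ := key g
    exact ⟨c, by simp only [hc]⟩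

/-- The elements of `k` that fix a vector under `z ↦ h(0, z)`. -/
def zStabilizer (π : Representation ℂ (GSp4 k) V) (v : V) : AddSubgroup k where
  carrier := {z | π (heis 0 0 z) v = v}
  zero_mem' := by simp [heis_zero]
  add_mem' {x y} hx hy := by
    have : (heis 0 0 (x + y) : GSp4 k) = heis 0 0 x * heis 0 0 y := by rw [heis_mul]; simp
    rw [Set.mem_ofPred_eq] at *
    rw [this, map_mul, Module.End.mul_apply, hy, hx]
  neg_mem' {x} hx := by
    have : (heis 0 0 (-x) : GSp4 k) * heis 0 0 x = 1 := by rw [heis_mul, ← heis_zero]; simp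
    rw [Set.mem_ofPred_eq] at *
    conv_lhs => rw [← hx]
    rw [← Module.End.mul_apply, ← map_mul, this, map_one, Module.End.one_apply]

theorem IsSmooth.isOpen_zStabilizer (hπ : IsSmooth π) (v : V) :
    IsOpen (zStabilizer π v : Set k) :=
  (hπ v).preimage continuous_heis_zero_zero

/-- If `Z` does not act trivially, some nontrivial continuous character of `Z` occurs in a quotient
of `π`. -/
theorem exists_nontrivial_character (hπ : IsSmooth π) {z₀ : k} {v : V}
    (hv : π (heis 0 0 z₀) v ≠ v) : ∃ (χ : AddChar k ℂ) (l : V →ₗ[ℂ] ℂ), Continuous χ ∧ χ ≠ 1 ∧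
      l ≠ 0 ∧ ∀ z x, l (π (heis 0 0 z) x) = χ z * l x := by
  -- A functional detecting `w = z₀ v - v` cannot be `Z`-invariant.
  set w := π (heis 0 0 z₀) v - v
  obtain ⟨χ₀, l, hlw, hl⟩ := exists_equivariant_functional (π.comp zHom)
    (fun a x => by
      obtain ⟨n, hn, h⟩ := exists_nsmul_mem (hπ.isOpen_zStabilizer x) a.toAdd
      exact ⟨n, hn, by rw [← map_pow]; exact h⟩) (sub_ne_zero.mpr hv)
  replace hl (z : k) (x : V) : l (π (heis 0 0 z) x) = χ₀ (Multiplicative.ofAdd z) * l x :=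
    hl (Multiplicative.ofAdd z) x
  let χ : AddChar k ℂ :=
    { toFun := fun z => χ₀ (Multiplicative.ofAdd z)
      map_zero_eq_one' := by
        have := hl 0 w
        rw [heis_zero, map_one, Module.End.one_apply] at this
        exact mul_right_cancel₀ hlw (by rw [← this, one_mul])
      map_add_eq_mul' := fun x y => by
        refine mul_right_cancel₀ hlw ?_
        have : (heis 0 0 (x + y) : GSp4 k) = heis 0 0 x * heis 0 0 y := by rw [heis_mul]; simp
        rw [← hl, this, map_mul, Module.End.mul_apply, hl, hl, mul_assoc] }
  replace hl : ∀ z x, l (π (heis 0 0 z) x) = χ z * l x := hl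
  refine ⟨χ, l, ?_, fun h1 => hlw ?_, fun h0 => hlw (by rw [h0, LinearMap.zero_apply]), hl⟩
  · have hker {z : k} (hz : z ∈ zStabilizer π w) : χ z = 1 := by
      have := hl z w
      rw [show π (heis 0 0 z) w = w from hz] at this
      exact mul_right_cancel₀ hlw (by rw [← this, one_mul])
    refine continuous_iff_continuousAt.mpr fun a => ?_
    refine (continuousAt_const (y := χ a)).congr ?_
    have hmem : {z | z - a ∈ zStabilizer π w} ∈ nhds a :=
      ((hπ.isOpen_zStabilizer w).preimage (continuous_sub_right a)).mem_nhds
        (by simp [(zStabilizer π w).zero_mem])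
    filter_upwards [hmem] with z hz
    rw [← sub_add_cancel z a, AddChar.map_add_eq_mul, hker hz, one_mul]
  · rw [map_sub, hl, h1, AddChar.one_apply, one_mul, sub_self]

end LocalField

end FourierJacobi

theorem mainTheorem7 {k : Type*} [Field k] [ValuativeRel k] [TopologicalSpace k]
    [IsNonarchimedeanLocalField k] (hk : (2 : k) ≠ 0)
    {V : Type*} [AddCommGroup V] [Module ℂ V]
    (π : Representation ℂ (FourierJacobi.GSp4 k) V)
    (hirr : π.IsIrreducible) (hsmooth : FourierJacobi.IsSmooth π)
    (hdim : Module.finrank ℂ V ≠ 1)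
    (ψ : AddChar k ℂ) (hψ : Continuous ψ) (hψ1 : ψ ≠ 1) :
    FourierJacobi.homZ π ψ ≠ ⊥ := by
  open FourierJacobi in
  obtain ⟨z₀, v, hv⟩ : ∃ (z₀ : k) (v : V), π (heis 0 0 z₀) v ≠ v := by
    by_contra! h
    exact hdim (finrank_eq_one_of_heis_mem_ker hirr hsmooth fun z =>
      MonoidHom.mem_ker.mpr (LinearMap.ext (h z)))
  obtain ⟨χ, l, hχ, hχ1, hl0, hl⟩ := exists_nontrivial_character hsmooth hv
  obtain ⟨c, hc⟩ := exists_forall_eq_mul hχ hχ1 hψ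
  have hc0 : c ≠ 0 := by
    rintro rfl
    exact hψ1 (DFunLike.ext _ _ fun x => by rw [hc]; simp)
  -- Conjugation by the torus turns `χ` into `ψ = χ (c ·)`.
  set t : GSp4 k := torus (Units.mk0 c hc0)⁻¹ with ht
  have hconj (z : k) : t * heis 0 0 z = heis 0 0 (c * z) * t := by
    rw [ht, ← torus_mul_heis]
    simp [hc0]
  refine (Submodule.ne_bot_iff _).mpr ⟨l ∘ₗ π t, fun z x => ?_, fun h0 => hl0 ?_⟩
  · change l (π t (π (heis 0 0 z) x)) = ψ z * l (π t x)
    rw [← Module.End.mul_apply, ← map_mul, hconj, map_mul, Module.End.mul_apply, hl, hc]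
  · ext x
    have := LinearMap.congr_fun h0 (π t⁻¹ x)
    rwa [LinearMap.comp_apply, ← Module.End.mul_apply, ← map_mul, mul_inv_cancel, map_one,
      Module.End.one_apply] at this
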